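/- Consider the diophantine system $$x_1^r+x_2^r+x_3^r=y_1^r+y_2^r+y_3^r+y_4^r+y_5^r,\qquad r=1,2,3,4. \tag{S}$$ A solution is called trivial if two of the $y_j$ are $0$ and the remaining three are a permutation of $x_1,x_2,x_3$. For rational $u,v,w$ put $$\begin{aligned} x_1&=4uv+w+1, & x_2&=-4uv+w-1, & x_3&=-8u^2+8uv+4u-2, & y_1&=4u-2,\\ y_2&=-4u, & y_3&=4uv+w-1, & y_4&=-4uv+w+1, & y_5&=-8u^2+8uv+4u, \end{aligned} \tag{P}$$ and let $$N(u,v)=4u^3-8u^2v+4uv^2-4u^2+4uv+u-v,\qquad Q(u,v)=24uv^2-2(4u-1)^2v+3u(2u-1)^2 .$$ 1. The values (P) satisfy (S) for $r=1,2$, for all $u,v,w$. If $u\ne0$ and $u\neq\frac12$, they satisfy (S) for $r=1,2,3,4$ if and only if $vw=N(u,v)$ and $Q(u,v)=0$. If $u=0$ or $u=\frac12$, $v\ne 0$ and $w=N(u,v)/v$, they give a trivial solution of (S). 2. For rational $u\neq0$, the equation $Q(u,v)=0$ has a rational root $v$ if and only if there is a rational $t$ with $$t^2=-32u^4+32u^3+24u^2-16u+1.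 \tag{C}$$ If $(u,t)$ is a rational point of (C) with $u\ne0$, the roots of $Q(u,\cdot)$ are $v=\frac{(4u-1)^2\pm t}{24u}$; they are nonzero if $u\neq\frac12$; and if $v=\frac{(4u-1)^2+t}{24u}\ne0$ and $w=N(u,v)/v$, then (P) is a solution of (S). 3. The curve (C) is birational over $\mathbb{Q}$ to $$E:\; Y^2=X^3-36X ,$$ through the mutually inverse isomorphisms of function fields given by $$u=\frac{X-12}{4X+Y-12},\qquad t=\frac{X^3-36X^2+36X-72Y+432}{(4X+Y-12)^2},$$ $$X=\frac{4u^2-8u+t+1}{2u^2},\qquad Y=\frac{8u^3+12u^2-4ut-12u+t+1}{2u^3}.$$ These formulas also map the affine rational points of $E$ with $4X+Y-12\neq0$ to rational points of (C), and the affine rational points of (C) with $u\ne0$ to rational points of $E$, and each of these two maps inverts the other wherever both are defined. 4. $E$ is an elliptic curve, and the point $P=(-3,9)$ has infinite order in $E(\mathbb{Q})$. 5. The system (S) has infinitely many nontrivial solutions in integers $x_1,x_2,x_3,y_1,\dots,y_5$ without a common factor. More precisely, infinitely many such solutions are rational multiples of the solutions (P) which belong, through 2 (with $u\neq 0$, $v=\frac{(4u-1)^2+t}{24u}\ne0$,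 $w=N(u,v)/v$) and 3, to the multiples $nP$, $n\ge0$, that are affine points with $4X+Y-12\neq0$. -/

import Mathlib

open Polynomial

namespace TarryEscott

/-- The system `∑ xᵢ ^ r = ∑ yⱼ ^ r`, `r = 1, …, k`, with `s₁` terms against `s₂` terms. -/
def IsSolution {R : Type*} [CommRing R] (k : ℕ) {s₁ s₂ : ℕ}
    (x : Fin s₁ → R) (y : Fin s₂ → R) : Prop :=
  ∀ r : ℕ, 1 ≤ r → r ≤ k → ∑ i, x i ^ r = ∑ j, y j ^ r

/-- A solution (with `s₁ ≤ s₂`) is trivial if `s₂ - s₁` of the `yⱼ` are zero and the remaining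
ones are a permutation of the `xᵢ`. -/
def IsTrivial {R : Type*} [CommRing R] {s₁ s₂ : ℕ}
    (x : Fin s₁ → R) (y : Fin s₂ → R) : Prop :=
  ∃ e : Fin s₁ ↪ Fin s₂, (∀ i, y (e i) = x i) ∧ ∀ j, j ∉ Set.range e → y j = 0

/-- The integers `xᵢ, yⱼ` have no common divisor other than `±1`. -/
def IsPrimitive {s₁ s₂ : ℕ} (x : Fin s₁ → ℤ) (y : Fin s₂ → ℤ) : Prop :=
  ∀ d : ℤ, (∀ i, d ∣ x i) → (∀ j, d ∣ y j) → IsUnit d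

/-- The three left-hand terms of the parametrization. -/
def paramX (u v w : ℚ) : Fin 3 → ℚ :=
  ![4 * u * v + w + 1, -4 * u * v + w - 1, -8 * u ^ 2 + 8 * u * v + 4 * u - 2]

/-- The five right-hand terms of the parametrization. -/
def paramY (u v w : ℚ) : Fin 5 → ℚ :=
  ![4 * u - 2, -4 * u, 4 * u * v + w - 1, -4 * u * v + w + 1, -8 * u ^ 2 + 8 * u * v + 4 * u]

/-- The numerator of the value of `w`: the cubic equation of the system reads `v * w = wNum u v`. -/
def wNum (u v : ℚ) : ℚ :=
  4 * u ^ 3 - 8 * u ^ 2 * v + 4 * u * v ^ 2 - 4 * u ^ 2 + 4 * u * v + u - v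

/-- The quadratic in `v` to which the quartic equation of the system reduces. -/
def vQuad (u v : ℚ) : ℚ :=
  24 * u * v ^ 2 - 2 * (4 * u - 1) ^ 2 * v + 3 * u * (2 * u - 1) ^ 2

/-- The root of `vQuad u` belonging to the square root `t` of a quarter of its discriminant. -/
def vRoot (u t : ℚ) : ℚ := ((4 * u - 1) ^ 2 + t) / (24 * u)

/-- The affine equation `t² = -32u⁴ + 32u³ + 24u² - 16u + 1`. -/
def OnQuartic {K : Type*} [Field K] (u t : K) : Prop :=
  t ^ 2 = -32 * u ^ 4 + 32 * u ^ 3 + 24 * u ^ 2 - 16 * u + 1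

/-- The polynomial `-32u⁴ + 32u³ + 24u² - 16u + 1`. -/
noncomputable def quartic : ℚ[X] := -32 * X ^ 4 + 32 * X ^ 3 + 24 * X ^ 2 - 16 * X + 1

/-- The polynomial `T² - (-32u⁴ + 32u³ + 24u² - 16u + 1)` in `ℚ[u][T]`. -/
noncomputable def quarticPoly : ℚ[X][X] := X ^ 2 - C quartic

/-- The coordinate ring of the affine quartic curve over `ℚ`. -/
abbrev QuarticCoordinateRing : Type := AdjoinRoot quarticPoly

/-- The function field of the quartic curve over `ℚ`. -/
abbrev QuarticFunctionField : Type := FractionRing QuarticCoordinateRing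

theorem quarticPoly_monic : quarticPoly.Monic := monic_X_pow_sub_C _ two_ne_zero

theorem quarticPoly_irreducible : Irreducible quarticPoly := by
  by_contra h
  have hdeg : quarticPoly.natDegree = 2 := natDegree_X_pow_sub_C
  rcases (quarticPoly_monic.not_irreducible_iff_exists_add_mul_eq_coeff hdeg).1 h with
    ⟨a, b, h0, h1⟩
  simp only [quarticPoly, coeff_sub, coeff_X_pow, coeff_C] at h0 h1
  norm_num at h0 h1
  have h0' := congrArg (eval 2) h0
  have h1' := congrArg (eval 2) h1
  simp [quartic] at h0' h1'
  norm_num at h0'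
  have hb : eval 2 b = -eval 2 a := by linarith
  rw [hb] at h0'
  nlinarith [sq_nonneg (eval 2 a)]

instance : IsDomain QuarticCoordinateRing :=
  AdjoinRoot.isDomain_of_prime quarticPoly_irreducible.prime

/-- The coordinate function `u` on the quartic curve. -/
noncomputable def uGen : QuarticFunctionField :=
  algebraMap QuarticCoordinateRing QuarticFunctionField (AdjoinRoot.of quarticPoly X)

/-- The coordinate function `t` on the quartic curve. -/
noncomputable def tGen : QuarticFunctionField :=
  algebraMap QuarticCoordinateRing QuarticFunctionField (AdjoinRoot.root quarticPoly)

/-- The Weierstrass curve `Y² = X³ - 36X` over `ℚ`. -/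
abbrev E : WeierstrassCurve.Affine ℚ := { a₁ := 0, a₂ := 0, a₃ := 0, a₄ := -36, a₆ := 0 }

/-- The coordinate function `X` on `E`. -/
noncomputable def xGen : E.FunctionField :=
  algebraMap E.CoordinateRing E.FunctionField (WeierstrassCurve.Affine.CoordinateRing.mk E (C X))

/-- The coordinate function `Y` on `E`. -/
noncomputable def yGen : E.FunctionField :=
  algebraMap E.CoordinateRing E.FunctionField (WeierstrassCurve.Affine.CoordinateRing.mk E X)

theorem nonsingular_P : E.Nonsingular (-3) 9 := by
  rw [WeierstrassCurve.Affine.nonsingular_iff, WeierstrassCurve.Affine.equation_iff]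
  norm_num

/-- The rational point `(-3, 9)` of `E`. -/
def P : E.Point := .some (-3) 9 nonsingular_P

section Birational

variable {K : Type*} [Field K]

/-- `u` as a rational function of `X`, `Y`. -/
def toU (X Y : K) : K := (X - 12) / (4 * X + Y - 12)

/-- `t` as a rational function of `X`, `Y`. -/
def toT (X Y : K) : K :=
  (X ^ 3 - 36 * X ^ 2 + 36 * X - 72 * Y + 432) / (4 * X + Y - 12) ^ 2

/-- `X` as a rational function of `u`, `t`. -/
def toX (u t : K) : K := (4 * u ^ 2 - 8 * u + t + 1) / (2 * u ^ 2)

/-- `Y` as a rational function of `u`, `t`. -/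
def toY (u t : K) : K :=
  (8 * u ^ 3 + 12 * u ^ 2 - 4 * u * t - 12 * u + t + 1) / (2 * u ^ 3)

end Birational

/-- `(x, y)` is a nonzero rational multiple of the solution which the parametrization attaches to
a point `(X, Y)` of `E`, by way of the corresponding point `(u, t)` of the quartic. -/
def ComesFrom (X Y : ℚ) (x : Fin 3 → ℤ) (y : Fin 5 → ℤ) : Prop :=
  4 * X + Y - 12 ≠ 0 ∧ ∃ u t v w c : ℚ,
    u = toU X Y ∧ t = toT X Y ∧ u ≠ 0 ∧ v = vRoot u t ∧ v ≠ 0 ∧ w = wNum u v / v ∧ c ≠ 0 ∧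
    (∀ i, (x i : ℚ) = c * paramX u v w i) ∧ ∀ j, (y j : ℚ) = c * paramY u v w j

end TarryEscott

/-! The power sums of degrees 1 and 2 agree identically. The cubic defect is `96u(vw - N)`, and `v`
times the quartic defect lies in the ideal of `vw - N` and `u²(2u-1)²Q` (`cubic_defect`,
`quartic_defect`); away from `u = 0, 1/2` the system is therefore `vw = N`, `Q = 0`. Completing the
square in `v` turns `Q = 0` into the quartic curve (C), and algebraic identities match (C) with `E`.

Infinitude is a 2-adic argument. Doubling a point with `|X| = q²`, `|Y| = q³`, `q ≥ 2`, replaces `q`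
by `2q`, so `2^(k+1) • P` has `q = 2^(k+1)` (`exists_two_pow_smul_P`). These points are distinct,
which makes `P` of infinite order. They have `|u| = 1/q < 1` (`padicNorm_toU`), which keeps `u` away
from the few values where too many `yⱼ` vanish (`paramY_ne_zero`). The ratio `y₀/y₁`, which scaling
does not change, determines `|u|`, so different `k` give different primitive solutions. -/

namespace TarryEscott

/-! ### The parametrization and its power-sum defects. -/

section Parametrization

variable (u v w : ℚ)

theorem isSolution_two_param : IsSolution 2 (paramX u v w) (paramY u v w) := by
  intro r h1 h2
  interval_cases r <;> simp [Fin.sum_univ_succ, paramX, paramY] <;> ring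

theorem cubic_defect :
    ∑ i, paramX u v w i ^ 3 - ∑ j, paramY u v w j ^ 3 = 96 * u * (v * w - wNum u v) := by
  simp [Fin.sum_univ_succ, paramX, paramY, wNum]
  ring

/-- The factor `v` allows `vw` to be compared with `N` without dividing; once `vw = N`, only the
term with `Q` survives. -/
theorem quartic_defect :
    v * (∑ i, paramX u v w i ^ 4 - ∑ j, paramY u v w j ^ 4) =
      192 * u * (v * w + wNum u v) * (v * w - wNum u v) +
        64 * u ^ 2 * (2 * u - 1) ^ 2 * vQuad u v := by
  simp [Fin.sum_univ_succ, paramX, paramY, wNum, vQuad]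
  ring

variable {u v w}

theorem isSolution_four_param_iff_sum :
    IsSolution 4 (paramX u v w) (paramY u v w) ↔
      ∑ i, paramX u v w i ^ 3 - ∑ j, paramY u v w j ^ 3 = 0 ∧
      ∑ i, paramX u v w i ^ 4 - ∑ j, paramY u v w j ^ 4 = 0 := by
  simp only [sub_eq_zero]
  refine ⟨fun h => ⟨h 3 (by norm_num) (by norm_num), h 4 (by norm_num) le_rfl⟩, ?_⟩
  rintro ⟨h3, h4⟩ r hr1 hr4
  obtain h | rfl | rfl : r ≤ 2 ∨ r = 3 ∨ r = 4 := by omega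
  exacts [isSolution_two_param u v w r hr1 h, h3, h4]

theorem isSolution_four_param (hv : v ≠ 0) (hw : v * w = wNum u v)
    (h : u = 0 ∨ 2 * u - 1 = 0 ∨ vQuad u v = 0) :
    IsSolution 4 (paramX u v w) (paramY u v w) := by
  have hz : 64 * u ^ 2 * (2 * u - 1) ^ 2 * vQuad u v = 0 := by
    rcases h with h | h | h <;> simp [h]
  refine isSolution_four_param_iff_sum.2 ⟨by rw [cubic_defect, hw]; ring, ?_⟩
  have h4 := quartic_defect u v w
  rw [hz, hw, sub_self, mul_zero, add_zero] at h4
  exact (mul_eq_zero.1 h4).resolve_left hv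

/-- The constant term of `Q` in `v` is `3u(2u-1)²`. -/
theorem vQuad_root_ne_zero (hu : u ≠ 0) (hu' : 2 * u - 1 ≠ 0) (h : vQuad u v = 0) : v ≠ 0 := by
  rintro rfl
  have : 3 * u * (2 * u - 1) ^ 2 = 0 := by simpa [vQuad] using h
  simp [hu, hu'] at this

theorem isSolution_four_param_iff (hu : u ≠ 0) (hu' : 2 * u - 1 ≠ 0) :
    IsSolution 4 (paramX u v w) (paramY u v w) ↔ v * w = wNum u v ∧ vQuad u v = 0 := by
  refine ⟨fun h => ?_, fun h =>
    isSolution_four_param (vQuad_root_ne_zero hu hu' h.2) h.1 (.inr (.inr h.2))⟩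
  obtain ⟨h3, h4⟩ := isSolution_four_param_iff_sum.1 h
  rw [cubic_defect] at h3
  have hw : v * w - wNum u v = 0 := (mul_eq_zero.1 h3).resolve_left (by simpa using hu)
  refine ⟨sub_eq_zero.1 hw, ?_⟩
  have hq := quartic_defect u v w
  rw [h4, hw, mul_zero, mul_zero, zero_add] at hq
  exact (mul_eq_zero.1 hq.symm).resolve_left (by simp [hu, hu'])

theorem isTrivial_param (h : u = 0 ∨ 2 * u - 1 = 0) (hv : v ≠ 0) (hw : w = wNum u v / v) :
    IsTrivial (paramX u v w) (paramY u v w) := by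
  rcases h with rfl | h
  · have hw' : w = -1 := by rw [hw, div_eq_iff hv]; simp [wNum]
    subst hw'
    -- At `u = 0`, `w = -1` the terms `y₁` and `y₄` (counted from 0) vanish.
    refine ⟨⟨![3, 2, 0], by decide⟩, fun i => ?_, fun j hj => ?_⟩
    · fin_cases i <;> simp [paramX, paramY]
    · fin_cases j <;> simp [paramY] at hj ⊢
  · obtain rfl : u = 1 / 2 := by linarith
    have hw' : w = 2 * v - 1 := by rw [hw, div_eq_iff hv]; simp [wNum]; ring
    subst hw'
    -- At `u = 1/2`, `w = 2v - 1` the terms `y₀` and `y₃` (counted from 0) vanish.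
    refine ⟨⟨![4, 1, 2], by decide⟩, fun i => ?_, fun j hj => ?_⟩
    · fin_cases i <;> simp [paramX, paramY] <;> ring
    · fin_cases j <;> simp [paramY] at hj ⊢ <;> ring

end Parametrization

/-! ### From the quadratic in `v` to the quartic curve. -/

theorem discriminant_vQuad (u v : ℚ) :
    24 * u * vQuad u v = (24 * u * v - (4 * u - 1) ^ 2) ^ 2 -
      (-32 * u ^ 4 + 32 * u ^ 3 + 24 * u ^ 2 - 16 * u + 1) := by
  simp only [vQuad]
  ring

theorem vQuad_eq_zero_iff_onQuartic {u : ℚ} (hu : u ≠ 0) (v : ℚ) :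
    vQuad u v = 0 ↔ OnQuartic u (24 * u * v - (4 * u - 1) ^ 2) := by
  have h := discriminant_vQuad u v
  rw [OnQuartic, ← sub_eq_zero (b := (_ : ℚ) + 1), ← h, mul_eq_zero]
  simp [hu]

theorem vQuad_eq_zero_iff {u t : ℚ} (hu : u ≠ 0) (h : OnQuartic u t) (v : ℚ) :
    vQuad u v = 0 ↔ v = vRoot u t ∨ v = vRoot u (-t) := by
  rw [vQuad_eq_zero_iff_onQuartic hu, OnQuartic, ← h, sq_eq_sq_iff_eq_or_eq_neg, vRoot, vRoot,
    eq_div_iff (by simpa using hu), eq_div_iff (by simpa using hu), sub_eq_iff_eq_add,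
    sub_eq_iff_eq_add, mul_comm v, add_comm t, add_comm (-t)]

theorem exists_vQuad_root_iff {u : ℚ} (hu : u ≠ 0) :
    (∃ v : ℚ, vQuad u v = 0) ↔ ∃ t : ℚ, OnQuartic u t :=
  ⟨fun ⟨v, hv⟩ => ⟨_, (vQuad_eq_zero_iff_onQuartic hu v).1 hv⟩,
    fun ⟨_, ht⟩ => ⟨_, (vQuad_eq_zero_iff hu ht _).2 (.inl rfl)⟩⟩

/-! ### The birational formulas as identities over a field. -/

section Birational

variable {K : Type*} [Field K]

theorem onQuartic_toU_toT {X Y : K} (h : Y ^ 2 = X ^ 3 - 36 * X) (hd : 4 * X + Y - 12 ≠ 0) :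
    OnQuartic (toU X Y) (toT X Y) := by
  simp only [OnQuartic, toU, toT]
  field_simp
  grind

variable [CharZero K]

theorem toX_toU_toT {X Y : K} (h : Y ^ 2 = X ^ 3 - 36 * X) (hd : 4 * X + Y - 12 ≠ 0)
    (hX : X - 12 ≠ 0) : toX (toU X Y) (toT X Y) = X := by
  simp only [toX, toU, toT]
  field_simp
  grind

theorem toY_toU_toT {X Y : K} (h : Y ^ 2 = X ^ 3 - 36 * X) (hd : 4 * X + Y - 12 ≠ 0)
    (hX : X - 12 ≠ 0) : toY (toU X Y) (toT X Y) = Y := by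
  -- Taking the denominator `D` itself as a variable keeps the cleared fractions simple.
  obtain ⟨D, rfl⟩ : ∃ D, Y = D - 4 * X + 12 := ⟨4 * X + Y - 12, by ring⟩
  have hD : 4 * X + (D - 4 * X + 12) - 12 = D := by ring
  simp only [toY, toU, toT, hD] at *
  field_simp
  grind

theorem toX_toY_equation {u t : K} (h : OnQuartic u t) (hu : u ≠ 0) :
    toY u t ^ 2 = toX u t ^ 3 - 36 * toX u t := by
  simp only [OnQuartic, toX, toY] at *
  field_simp
  grind

theorem denominator_toX_toY {u t : K} (hu : u ≠ 0) :
    4 * toX u t + toY u t - 12 = (-20 * u ^ 2 - 8 * u + t + 1) / (2 * u ^ 3) := by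
  simp only [toX, toY]
  field_simp
  ring

theorem toU_toX_toY {u t : K} (hu : u ≠ 0) (hd : 4 * toX u t + toY u t - 12 ≠ 0) :
    toU (toX u t) (toY u t) = u := by
  rw [toU, div_eq_iff hd, denominator_toX_toY hu, toX]
  field_simp
  ring

theorem toT_toX_toY {u t : K} (h : OnQuartic u t) (hu : u ≠ 0)
    (hd : 4 * toX u t + toY u t - 12 ≠ 0) : toT (toX u t) (toY u t) = t := by
  rw [toT, div_eq_iff (pow_ne_zero _ hd), denominator_toX_toY hu]
  simp only [OnQuartic, toX, toY] at *
  field_simp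
  grind

end Birational

section Map

variable {K L : Type*} [Field K] [Field L] (f : K →+* L) (a b : K)

theorem map_toU : f (toU a b) = toU (f a) (f b) := by simp [toU, map_ofNat]

theorem map_toT : f (toT a b) = toT (f a) (f b) := by simp [toT, map_ofNat]

theorem map_toX : f (toX a b) = toX (f a) (f b) := by simp [toX, map_ofNat]

theorem map_toY : f (toY a b) = toY (f a) (f b) := by simp [toY, map_ofNat]

end Map

/-! ### Function fields and their isomorphism. -/

section FunctionField

variable {L : Type*} [Field L] [Algebra ℚ L]

/-- The elements algebraic over `ℚ` form a subfield, and `toU` uses only field operations. -/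
theorem isAlgebraic_toU {X Y : L} (hX : IsAlgebraic ℚ X) (hY : IsAlgebraic ℚ Y) :
    IsAlgebraic ℚ (toU X Y) := by
  have h := map_toU (algebraMap (algebraicClosure ℚ L) L) ⟨X, mem_algebraicClosure_iff.2 hX⟩
    ⟨Y, mem_algebraicClosure_iff.2 hY⟩
  exact mem_algebraicClosure_iff.1 (h ▸ (toU _ _ : algebraicClosure ℚ L).2)

theorem isAlgebraic_toX {u t : L} (hu : IsAlgebraic ℚ u) (ht : IsAlgebraic ℚ t) :
    IsAlgebraic ℚ (toX u t) := by
  have h := map_toX (algebraMap (algebraicClosure ℚ L) L) ⟨u, mem_algebraicClosure_iff.2 hu⟩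
    ⟨t, mem_algebraicClosure_iff.2 ht⟩
  exact mem_algebraicClosure_iff.1 (h ▸ (toX _ _ : algebraicClosure ℚ L).2)

theorem isAlgebraic_of_sq_eq_aeval {a b : L} (ha : IsAlgebraic ℚ a) (p : ℚ[X])
    (h : b ^ 2 = aeval a p) : IsAlgebraic ℚ b := by
  have hp := aeval_algebraMap_apply L (⟨a, mem_algebraicClosure_iff.2 ha⟩ : algebraicClosure ℚ L) p
  exact .of_pow two_pos (h ▸ mem_algebraicClosure_iff.1
    (hp ▸ (aeval _ p : algebraicClosure ℚ L).2))

/-- The number `n` serves only to certify that `p` is not the zero polynomial. -/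
theorem transcendental_aeval_ne_zero {a : L} (ha : Transcendental ℚ a) {p : ℚ[X]} (n : ℚ)
    (hp : p.eval n ≠ 0) : aeval a p ≠ 0 := fun h =>
  hp (by rw [(transcendental_iff.1 ha) p h, eval_zero])

theorem transcendental_sub_ne_zero {a : L} (ha : Transcendental ℚ a) (q : ℚ) :
    a - algebraMap ℚ L q ≠ 0 := fun h => by
  rw [sub_eq_zero] at h
  exact ha (h ▸ isAlgebraic_algebraMap q)

theorem weierstrass_denominator_ne_zero {X Y : L} (hX : Transcendental ℚ X)
    (h : Y ^ 2 = X ^ 3 - 36 * X) : 4 * X + Y - 12 ≠ 0 := by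
  intro h0
  -- The cubic results from putting `Y = 12 - 4X` into the equation of `E`.
  refine transcendental_aeval_ne_zero hX
    (p := Polynomial.X ^ 3 - 16 * Polynomial.X ^ 2 + 60 * Polynomial.X - 144) 0 (by simp) ?_
  simp [map_ofNat]
  linear_combination -h + (Y - 4 * X + 12) * h0

/-- If `u` were algebraic, so would be `t`, whose square is a polynomial in `u`, and then `X`, which
is recovered from `u` and `t`. -/
theorem transcendental_toU {X Y : L} (hX : Transcendental ℚ X) (h : Y ^ 2 = X ^ 3 - 36 * X) :
    Transcendental ℚ (toU X Y) := by
  have := algebraRat.charZero L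
  have hd := weierstrass_denominator_ne_zero hX h
  intro hu
  have ht : IsAlgebraic ℚ (toT X Y) := isAlgebraic_of_sq_eq_aeval hu quartic (by
    simpa [quartic, map_ofNat, OnQuartic] using onQuartic_toU_toT h hd)
  have hX' := isAlgebraic_toX hu ht
  rw [toX_toU_toT h hd (by simpa using transcendental_sub_ne_zero hX 12)] at hX'
  exact hX hX'

theorem quartic_denominator_ne_zero {u t : L} (hu : Transcendental ℚ u) (h : OnQuartic u t) :
    4 * toX u t + toY u t - 12 ≠ 0 := by
  have := algebraRat.charZero L
  have hu0 : u ≠ 0 := by simpa using transcendental_sub_ne_zero hu 0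
  rw [denominator_toX_toY hu0]
  refine div_ne_zero (fun h0 => ?_) (by simpa using hu0)
  -- Vanishing means `t = 20u² + 8u - 1`; the polynomial is the square of this minus the quartic.
  refine transcendental_aeval_ne_zero hu
    (p := 432 * Polynomial.X ^ 4 + 288 * Polynomial.X ^ 3) 1 (by simp; norm_num) ?_
  rw [OnQuartic] at h
  simp [map_ofNat]
  linear_combination h - (t + 20 * u ^ 2 + 8 * u - 1) * h0

theorem transcendental_toX {u t : L} (hu : Transcendental ℚ u) (h : OnQuartic u t) :
    Transcendental ℚ (toX u t) := by
  have := algebraRat.charZero L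
  have hu0 : u ≠ 0 := by simpa using transcendental_sub_ne_zero hu 0
  intro hX
  have hY : IsAlgebraic ℚ (toY u t) :=
    isAlgebraic_of_sq_eq_aeval hX (Polynomial.X ^ 3 - 36 * Polynomial.X) (by
      simpa [map_ofNat] using toX_toY_equation h hu0)
  have hu' := isAlgebraic_toU hX hY
  rw [toU_toX_toY hu0 (quartic_denominator_ne_zero hu h)] at hu'
  exact hu hu'

variable {p : ℚ[X][X]}

theorem transcendental_algebraMap_of_X (hd : p.degree ≠ 0) :
    Transcendental ℚ
      (algebraMap (AdjoinRoot p) (FractionRing (AdjoinRoot p)) (AdjoinRoot.of p X)) := by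
  rw [transcendental_algebraMap_iff (IsFractionRing.injective _ _)]
  exact (transcendental_algebraMap_iff (R := ℚ) (S := ℚ[X])
    (AdjoinRoot.of.injective_of_degree_ne_zero hd)).2 (transcendental_X ℚ)

/-- `AdjoinRoot p` is a domain integral over `ℚ[X]`, so an ideal meeting `ℚ[X]` in zero is zero;
transcendence says that the kernel does so. Such a map extends to the fraction field. -/
theorem injective_of_transcendental (hp : p.Monic) [IsDomain (AdjoinRoot p)]
    (f : AdjoinRoot p →ₐ[ℚ] L) (hf : Transcendental ℚ (f (AdjoinRoot.of p X))) :
    Function.Injective f := by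
  have : Algebra.IsIntegral ℚ[X] (AdjoinRoot p) := have := hp.finite_adjoinRoot; inferInstance
  rw [RingHom.injective_iff_ker_eq_bot]
  refine Ideal.eq_bot_of_comap_eq_bot (R := ℚ[X]) (eq_bot_iff.2 fun q hq => ?_)
  have h : f.comp (AdjoinRoot.ofAlgHom ℚ p) = aeval (f (AdjoinRoot.of p X)) :=
    Polynomial.algHom_ext (by simp)
  have hq' : aeval (f (AdjoinRoot.of p X)) q = 0 := (DFunLike.congr_fun h q).symm.trans hq
  exact (transcendental_iff.1 hf) q hq'

theorem fractionRing_algHom_ext {f g : FractionRing (AdjoinRoot p) →ₐ[ℚ] L} [IsDomain (AdjoinRoot p)]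
    (hX : f (algebraMap _ _ (AdjoinRoot.of p X)) = g (algebraMap _ _ (AdjoinRoot.of p X)))
    (hroot : f (algebraMap _ _ (AdjoinRoot.root p)) = g (algebraMap _ _ (AdjoinRoot.root p))) :
    f = g := by
  have h : f.comp (IsScalarTower.toAlgHom ℚ (AdjoinRoot p) (FractionRing (AdjoinRoot p))) =
      g.comp (IsScalarTower.toAlgHom ℚ (AdjoinRoot p) (FractionRing (AdjoinRoot p))) :=
    AdjoinRoot.algHom_ext' (Polynomial.algHom_ext hX) hroot
  exact AlgHom.coe_ringHom_injective (IsFractionRing.ringHom_ext (A := AdjoinRoot p)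
    fun x => DFunLike.congr_fun h x)

end FunctionField

theorem exists_algHom_of_transcendental {p : ℚ[X][X]} (hp : p.Monic) [IsDomain (AdjoinRoot p)]
    {L : Type*} [Field L] [Algebra ℚ L] {a b : L} (ha : Transcendental ℚ a)
    (h : p.eval₂ (aeval a : ℚ[X] →ₐ[ℚ] L) b = 0) :
    ∃ f : FractionRing (AdjoinRoot p) →ₐ[ℚ] L,
      f (algebraMap _ _ (AdjoinRoot.of p X)) = a ∧ f (algebraMap _ _ (AdjoinRoot.root p)) = b := by
  have hg := injective_of_transcendental hp (AdjoinRoot.liftAlgHom p (aeval a) b h) (by simpa)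
  exact ⟨IsFractionRing.liftAlgHom hg, by simp, by simp⟩

theorem uGen_transcendental : Transcendental ℚ uGen :=
  transcendental_algebraMap_of_X (by
    rw [quarticPoly, degree_X_pow_sub_C two_pos]; decide)

theorem eval₂_quarticPoly {R : Type*} [CommRing R] (f : ℚ[X] →+* R) (b : R) :
    quarticPoly.eval₂ f b = b ^ 2 - (-32 * f X ^ 4 + 32 * f X ^ 3 + 24 * f X ^ 2 - 16 * f X + 1) := by
  simp only [quarticPoly, eval₂_sub, eval₂_pow, eval₂_X, eval₂_C]
  simp [quartic, map_ofNat]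

theorem onQuartic_uGen_tGen : OnQuartic uGen tGen := by
  have h := congrArg (algebraMap QuarticCoordinateRing QuarticFunctionField)
    (sub_eq_zero.1 ((eval₂_quarticPoly _ _).symm.trans (AdjoinRoot.eval₂_root quarticPoly)))
  simpa [OnQuartic, uGen, tGen, map_ofNat] using h

theorem E_polynomial_monic : E.polynomial.Monic := WeierstrassCurve.Affine.monic_polynomial

theorem xGen_transcendental : Transcendental ℚ xGen :=
  transcendental_algebraMap_of_X (by
    rw [WeierstrassCurve.Affine.degree_polynomial]; decide)

theorem eval₂_E_polynomial {R : Type*} [CommRing R] (f : ℚ[X] →+* R) (b : R) :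
    E.polynomial.eval₂ f b = b ^ 2 - (f X ^ 3 - 36 * f X) := by
  have h : E.polynomial = X ^ 2 - C (X ^ 3 - 36 * X) := by
    simp [WeierstrassCurve.Affine.polynomial, sub_eq_add_neg]
    exact map_ofNat C 36
  simp only [h, eval₂_sub, eval₂_pow, eval₂_X, eval₂_C]
  simp [map_ofNat]

theorem weierstrass_xGen_yGen : yGen ^ 2 = xGen ^ 3 - 36 * xGen := by
  have h := congrArg (algebraMap E.CoordinateRing E.FunctionField)
    (sub_eq_zero.1 ((eval₂_E_polynomial _ _).symm.trans (AdjoinRoot.eval₂_root E.polynomial)))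
  simp only [map_sub, map_mul, map_pow, map_ofNat] at h
  exact h

theorem exists_functionField_algEquiv :
    ∃ φ : QuarticFunctionField ≃ₐ[ℚ] E.FunctionField,
      φ uGen = toU xGen yGen ∧ φ tGen = toT xGen yGen ∧
      φ.symm xGen = toX uGen tGen ∧ φ.symm yGen = toY uGen tGen := by
  have hE := weierstrass_xGen_yGen
  have hQ := onQuartic_uGen_tGen
  have hdE := weierstrass_denominator_ne_zero xGen_transcendental hE
  have hdQ := quartic_denominator_ne_zero uGen_transcendental hQ
  have hu0 : uGen ≠ 0 := by simpa using transcendental_sub_ne_zero uGen_transcendental 0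
  have hx12 : xGen - 12 ≠ 0 := by simpa using transcendental_sub_ne_zero xGen_transcendental 12
  have hQ' := onQuartic_toU_toT hE hdE
  obtain ⟨hE', hu, ht⟩ : toY uGen tGen ^ 2 = toX uGen tGen ^ 3 - 36 * toX uGen tGen ∧
      toU (toX uGen tGen) (toY uGen tGen) = uGen ∧ toT (toX uGen tGen) (toY uGen tGen) = tGen := by
    have := algebraRat.charZero QuarticFunctionField
    exact ⟨toX_toY_equation hQ hu0, toU_toX_toY hu0 hdQ, toT_toX_toY hQ hu0 hdQ⟩
  obtain ⟨hx, hy⟩ : toX (toU xGen yGen) (toT xGen yGen) = xGen ∧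
      toY (toU xGen yGen) (toT xGen yGen) = yGen := by
    have := algebraRat.charZero E.FunctionField
    exact ⟨toX_toU_toT hE hdE hx12, toY_toU_toT hE hdE hx12⟩
  obtain ⟨φ, hφu, hφt⟩ := exists_algHom_of_transcendental quarticPoly_monic
    (transcendental_toU xGen_transcendental hE) (b := toT xGen yGen) (by
      rw [OnQuartic] at hQ'
      simp [eval₂_quarticPoly, hQ'])
  obtain ⟨ψ, hψx, hψy⟩ := exists_algHom_of_transcendental E_polynomial_monic
    (transcendental_toX uGen_transcendental hQ) (b := toY uGen tGen) (by
      simp [eval₂_E_polynomial, hE'])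
  change φ uGen = _ at hφu
  change φ tGen = _ at hφt
  change ψ xGen = _ at hψx
  change ψ yGen = _ at hψy
  refine ⟨AlgEquiv.ofAlgHom φ ψ (fractionRing_algHom_ext ?_ ?_) (fractionRing_algHom_ext ?_ ?_),
    hφu, hφt, hψx, hψy⟩
  · change φ (ψ xGen) = xGen
    rw [hψx]
    refine (map_toX φ.toRingHom _ _).trans ?_
    change toX (φ uGen) (φ tGen) = _
    rw [hφu, hφt, hx]
  · change φ (ψ yGen) = yGen
    rw [hψy]
    refine (map_toY φ.toRingHom _ _).trans ?_
    change toY (φ uGen) (φ tGen) = _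
    rw [hφu, hφt, hy]
  · change ψ (φ uGen) = uGen
    rw [hφu]
    refine (map_toU ψ.toRingHom _ _).trans ?_
    change toU (ψ xGen) (ψ yGen) = _
    rw [hψx, hψy, hu]
  · change ψ (φ tGen) = tGen
    rw [hφt]
    refine (map_toT ψ.toRingHom _ _).trans ?_
    change toT (ψ xGen) (ψ yGen) = _
    rw [hψx, hψy, ht]

/-! ### 2-adic growth on `E` and the infinite order of `P`. -/

theorem padicNorm_add_of_lt {a b : ℚ} (h : padicNorm 2 b < padicNorm 2 a) :
    padicNorm 2 (a + b) = padicNorm 2 a := by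
  rw [padicNorm.add_eq_max_of_ne h.ne', max_eq_left h.le]

theorem padicNorm_sub_of_lt {a b : ℚ} (h : padicNorm 2 b < padicNorm 2 a) :
    padicNorm 2 (a - b) = padicNorm 2 a := by
  rw [sub_eq_add_neg, padicNorm_add_of_lt (by rwa [padicNorm.neg])]

theorem padicNorm_pow (a : ℚ) (n : ℕ) : padicNorm 2 (a ^ n) = padicNorm 2 a ^ n := by
  induction n with
  | zero => simp
  | succ n ih => rw [pow_succ, pow_succ, padicNorm.mul, ih]

theorem padicNorm_two : padicNorm 2 2 = 1 / 2 := by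
  simpa using padicNorm.padicNorm_p (p := 2) one_lt_two

theorem padicNorm_three : padicNorm 2 3 = 1 := by
  simpa using (padicNorm.nat_eq_one_iff (p := 2) 3).2 (by norm_num)

theorem padicNorm_four : padicNorm 2 4 = 1 / 4 := by
  rw [show (4 : ℚ) = 2 ^ 2 by norm_num, padicNorm_pow, padicNorm_two]; norm_num

theorem padicNorm_twelve : padicNorm 2 12 = 1 / 4 := by
  rw [show (12 : ℚ) = 3 * 4 by norm_num, padicNorm.mul, padicNorm_three, padicNorm_four]; norm_num

theorem padicNorm_thirtySix : padicNorm 2 36 = 1 / 4 := by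
  rw [show (36 : ℚ) = 3 * 12 by norm_num, padicNorm.mul, padicNorm_three, padicNorm_twelve]
  norm_num

theorem E_equation_iff (X Y : ℚ) : E.Equation X Y ↔ Y ^ 2 = X ^ 3 - 36 * X := by
  rw [WeierstrassCurve.Affine.equation_iff]
  simp [sub_eq_add_neg]

theorem E_isElliptic : WeierstrassCurve.IsElliptic E := by
  rw [WeierstrassCurve.isElliptic_iff]
  norm_num [WeierstrassCurve.Δ, WeierstrassCurve.b₂, WeierstrassCurve.b₄, WeierstrassCurve.b₆,
    WeierstrassCurve.b₈]

theorem exists_double {X Y : ℚ} (h : E.Nonsingular X Y) (hY : Y ≠ 0) :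
    ∃ h', (WeierstrassCurve.Affine.Point.some X Y h : E.Point) + .some X Y h =
      .some (((3 * X ^ 2 - 36) / (2 * Y)) ^ 2 - 2 * X)
        (-((3 * X ^ 2 - 36) / (2 * Y) * (((3 * X ^ 2 - 36) / (2 * Y)) ^ 2 - 2 * X - X) + Y)) h' := by
  have hne : Y ≠ E.negY X Y := by
    simp only [WeierstrassCurve.Affine.negY]
    intro h0
    apply hY
    linarith
  have hs : E.slope X X Y Y = (3 * X ^ 2 - 36) / (2 * Y) := by
    rw [WeierstrassCurve.Affine.slope_of_Y_ne rfl hne]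
    simp only [WeierstrassCurve.Affine.negY]
    congr 1 <;> ring
  have hadd := WeierstrassCurve.Affine.Point.add_self_of_Y_ne (h₁ := h) hne
  have hx : E.addX X X (E.slope X X Y Y) = ((3 * X ^ 2 - 36) / (2 * Y)) ^ 2 - 2 * X := by
    rw [hs, WeierstrassCurve.Affine.addX]; ring
  have hy : E.addY X X Y (E.slope X X Y Y) =
      -((3 * X ^ 2 - 36) / (2 * Y) * (((3 * X ^ 2 - 36) / (2 * Y)) ^ 2 - 2 * X - X) + Y) := by
    rw [WeierstrassCurve.Affine.addY, WeierstrassCurve.Affine.negAddY, hx, hs,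
      WeierstrassCurve.Affine.negY]
    ring
  simp only [hx, hy] at hadd
  exact ⟨_, hadd⟩

/-- In each sum one term dominates 2-adically. The tangent slope has norm `q⁴ / (q³/2) = 2q`, its
square dominates the new `X`, and slope times `X` dominates the new `Y`. -/
theorem padicNorm_double {X Y q : ℚ} (hq : 2 ≤ q) (hX : padicNorm 2 X = q ^ 2)
    (hY : padicNorm 2 Y = q ^ 3) :
    padicNorm 2 (((3 * X ^ 2 - 36) / (2 * Y)) ^ 2 - 2 * X) = (2 * q) ^ 2 ∧
    padicNorm 2 (-((3 * X ^ 2 - 36) / (2 * Y) * (((3 * X ^ 2 - 36) / (2 * Y)) ^ 2 - 2 * X - X) + Y))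
      = (2 * q) ^ 3 := by
  have hq0 : 0 < q := by linarith
  have hnum : padicNorm 2 (3 * X ^ 2 - 36) = q ^ 4 := by
    have h3 : padicNorm 2 (3 * X ^ 2) = q ^ 4 := by
      rw [padicNorm.mul, padicNorm_pow, padicNorm_three, hX]; ring
    rw [padicNorm_sub_of_lt, h3]
    rw [h3, padicNorm_thirtySix]
    have : 1 ≤ q ^ 4 := one_le_pow₀ (by linarith)
    linarith
  have hs : padicNorm 2 ((3 * X ^ 2 - 36) / (2 * Y)) = 2 * q := by
    rw [padicNorm.div, hnum, padicNorm.mul, padicNorm_two, hY]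
    field_simp
  generalize (3 * X ^ 2 - 36) / (2 * Y) = s at hs ⊢
  have hx : padicNorm 2 (s ^ 2 - 2 * X) = (2 * q) ^ 2 := by
    rw [padicNorm_sub_of_lt, padicNorm_pow, hs]
    rw [padicNorm.mul, padicNorm_two, padicNorm_pow, hs, hX]
    nlinarith
  refine ⟨hx, ?_⟩
  have hx' : padicNorm 2 (s ^ 2 - 2 * X - X) = (2 * q) ^ 2 := by
    rw [padicNorm_sub_of_lt, hx]
    rw [hx, hX]
    nlinarith
  have hm : padicNorm 2 (s * (s ^ 2 - 2 * X - X)) = (2 * q) ^ 3 := by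
    rw [padicNorm.mul, hs, hx']; ring
  rw [padicNorm.neg, padicNorm_add_of_lt, hm]
  rw [hm, hY]
  have : 0 < q ^ 3 := by positivity
  linarith [show (2 * q) ^ 3 = 8 * q ^ 3 by ring]

/-- The exponent starts at 1 because `P` itself gives `u = 1`, `t = -3`, `v = 1/4`, `w = 0`, a
trivial solution. The base case is `2P = (25/4, -35/8)`. -/
theorem exists_two_pow_smul_P (k : ℕ) :
    ∃ (X Y : ℚ) (h : E.Nonsingular X Y), 2 ^ (k + 1) • P = .some X Y h ∧
      padicNorm 2 X = (2 ^ (k + 1)) ^ 2 ∧ padicNorm 2 Y = (2 ^ (k + 1)) ^ 3 := by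
  induction k with
  | zero =>
    obtain ⟨h, hP⟩ := exists_double nonsingular_P (by norm_num)
    refine ⟨_, _, h, by rw [zero_add, pow_one, two_nsmul]; exact hP, ?_, ?_⟩
    · rw [show (((3 * (-3) ^ 2 - 36) / (2 * 9)) ^ 2 - 2 * (-3) : ℚ) = ((25 : ℕ) : ℚ) / 4 by norm_num,
        padicNorm.div, (padicNorm.nat_eq_one_iff (p := 2) 25).2 (by norm_num), padicNorm_four]
      norm_num
    · rw [show (-((3 * (-3) ^ 2 - 36) / (2 * 9) *
          (((3 * (-3) ^ 2 - 36) / (2 * 9)) ^ 2 - 2 * (-3) - (-3)) + 9) : ℚ) =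
          -(((35 : ℕ) : ℚ) / (2 * 4)) by norm_num,
        padicNorm.neg, padicNorm.div, (padicNorm.nat_eq_one_iff (p := 2) 35).2 (by norm_num),
        padicNorm.mul, padicNorm_four, padicNorm_two]
      norm_num
  | succ k ih =>
    obtain ⟨X, Y, h, hP, hX, hY⟩ := ih
    have hY0 : Y ≠ 0 := by
      rintro rfl
      rw [padicNorm.zero] at hY
      exact absurd hY (by positivity)
    obtain ⟨h', hP'⟩ := exists_double h hY0
    have hd := padicNorm_double (by
      simpa using pow_le_pow_right₀ (one_le_two (α := ℚ)) (Nat.le_add_left 1 k)) hX hY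
    refine ⟨_, _, h', by rw [pow_succ, mul_nsmul, hP, two_nsmul]; exact hP', ?_, ?_⟩
    · rw [hd.1]; ring
    · rw [hd.2]; ring

/-- A torsion point has finitely many multiples, whereas the points `2^(k+1) • P` have pairwise
different `|X|`. -/
theorem nsmul_P_ne_zero {n : ℕ} (hn : 0 < n) : n • P ≠ 0 := by
  intro h0
  have hfin : (Set.range fun m : ℕ => m • P).Finite := by
    refine ((Set.finite_lt_nat n).image fun m => m • P).subset ?_
    rintro _ ⟨m, rfl⟩
    exact ⟨m % n, Nat.mod_lt _ hn, by
      conv_rhs => rw [← Nat.mod_add_div m n]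
      simp [add_nsmul, mul_nsmul, h0]⟩
  have hinj : Function.Injective fun k : ℕ => 2 ^ (k + 1) • P := by
    intro k l hkl
    obtain ⟨X, Y, h, hP, hX, -⟩ := exists_two_pow_smul_P k
    obtain ⟨X', Y', h', hP', hX', -⟩ := exists_two_pow_smul_P l
    simp only [hP, hP', WeierstrassCurve.Affine.Point.some.injEq] at hkl
    rw [hkl.1, hX', ← pow_mul, ← pow_mul] at hX
    have := pow_right_injective₀ (two_pos (α := ℚ)) (by norm_num) hX
    omega
  exact (Set.infinite_range_of_injective hinj) (hfin.subset
    (Set.range_subset_iff.2 fun k => ⟨2 ^ (k + 1), rfl⟩))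

/-- `X` dominates the numerator and `Y` the denominator, so the norm is `q²/q³`. -/
theorem padicNorm_toU {X Y q : ℚ} (hq : 2 ≤ q) (hX : padicNorm 2 X = q ^ 2)
    (hY : padicNorm 2 Y = q ^ 3) : 4 * X + Y - 12 ≠ 0 ∧ padicNorm 2 (toU X Y) = 1 / q := by
  have hq0 : 0 < q := by linarith
  have hq1 : 1 ≤ q ^ 2 := one_le_pow₀ (by linarith)
  have hq2 : q ^ 2 ≤ q ^ 3 := pow_le_pow_right₀ (by linarith) (by norm_num)
  have hd : padicNorm 2 (4 * X + Y - 12) = q ^ 3 := by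
    have h1 : padicNorm 2 (4 * X + Y) = q ^ 3 := by
      rw [add_comm, padicNorm_add_of_lt, hY]
      rw [padicNorm.mul, padicNorm_four, hX, hY]
      linarith
    rw [padicNorm_sub_of_lt, h1]
    rw [h1, padicNorm_twelve]
    linarith
  refine ⟨fun h0 => ?_, ?_⟩
  · rw [h0, padicNorm.zero] at hd
    exact (pow_pos hq0 3).ne hd
  · rw [toU, padicNorm.div, hd, padicNorm_sub_of_lt, hX]
    · field_simp
    · rw [padicNorm_twelve, hX]
      linarith

/-! ### Nontrivial primitive integer solutions. -/

theorem exists_primitive_multiple {ι : Type*} [Fintype ι] (f : ι → ℚ) {i₀ : ι} (h : f i₀ ≠ 0) :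
    ∃ (c : ℚ) (g : ι → ℤ), c ≠ 0 ∧ (∀ i, (g i : ℚ) = c * f i) ∧
      ∀ d : ℤ, (∀ i, d ∣ g i) → IsUnit d := by
  obtain ⟨b, hb⟩ := IsLocalization.exist_integer_multiples_of_finite (nonZeroDivisors ℤ) f
  choose g hg using hb
  have hb0 : ((b : ℤ) : ℚ) ≠ 0 := by exact_mod_cast nonZeroDivisors.coe_ne_zero b
  have hg' : ∀ i, (g i : ℚ) = (b : ℤ) * f i := fun i => by simpa using hg i
  have hgi : g i₀ ≠ 0 := by
    have : (g i₀ : ℚ) ≠ 0 := by rw [hg']; exact mul_ne_zero hb0 h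
    exact_mod_cast this
  obtain ⟨g', hg₁, hg₂⟩ := Finset.extract_gcd g (s := Finset.univ) ⟨i₀, Finset.mem_univ _⟩
  have hD : (Finset.univ.gcd g : ℤ) ≠ 0 := fun h0 =>
    hgi (Finset.gcd_eq_zero_iff.1 h0 i₀ (Finset.mem_univ _))
  have hD' : ((Finset.univ.gcd g : ℤ) : ℚ) ≠ 0 := by exact_mod_cast hD
  refine ⟨(b : ℤ) / (Finset.univ.gcd g : ℤ), g', div_ne_zero hb0 hD', fun i => ?_, fun d hd =>
    isUnit_of_dvd_one (hg₂ ▸ Finset.dvd_gcd fun i _ => hd i)⟩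
  rw [div_mul_eq_mul_div, ← hg', eq_div_iff hD', mul_comm]
  exact_mod_cast (hg₁ i (Finset.mem_univ _)).symm

/-- In a trivial solution at most three of the five `yⱼ` are nonzero; here four are. -/
theorem not_isTrivial {R : Type*} [CommRing R] {x : Fin 3 → R} {y : Fin 5 → R} (h0 : y 0 ≠ 0)
    (h1 : y 1 ≠ 0) (h4 : y 4 ≠ 0) (h23 : y 2 ≠ 0 ∨ y 3 ≠ 0) : ¬ IsTrivial x y := by
  rintro ⟨e, -, he⟩
  have hmem : ∀ j, y j ≠ 0 → j ∈ Finset.univ.map e := fun j hj => by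
    by_contra hj'
    exact hj (he j (by simpa using hj'))
  have hcard : (Finset.univ.map e).card = 3 := by simp
  have hsub : ∀ j, y j ≠ 0 → ({0, 1, 4, j} : Finset (Fin 5)) ⊆ Finset.univ.map e := fun j hj => by
    simp only [Finset.insert_subset_iff, Finset.singleton_subset_iff]
    exact ⟨hmem _ h0, hmem _ h1, hmem _ h4, hmem _ hj⟩
  rcases h23 with h | h
  · exact absurd (Finset.card_le_card (hsub 2 h)) (by rw [hcard]; decide)
  · exact absurd (Finset.card_le_card (hsub 3 h)) (by rw [hcard]; decide)

/-- Each unwanted vanishing forces `u` to be `1`, `±1/2` or a root of `6u² - 3u - 1`, and none of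
these has 2-adic norm below 1. -/
theorem paramY_ne_zero {u v w : ℚ} (hu : u ≠ 0) (hu1 : padicNorm 2 u < 1)
    (hv : vQuad u v = 0) :
    paramY u v w 0 ≠ 0 ∧ paramY u v w 1 ≠ 0 ∧ paramY u v w 4 ≠ 0 ∧
      (paramY u v w 2 ≠ 0 ∨ paramY u v w 3 ≠ 0) := by
  have h1 : u - 1 ≠ 0 := fun h => by
    rw [sub_eq_zero.1 h, padicNorm.one] at hu1
    exact lt_irrefl _ hu1
  have h2 : 2 * u - 1 ≠ 0 := fun h => by
    rw [show u = 1 / 2 by linarith, padicNorm.div, padicNorm.one, padicNorm_two] at hu1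
    norm_num at hu1
  have h3 : 2 * u + 1 ≠ 0 := fun h => by
    rw [show u = -(1 / 2) by linarith, padicNorm.neg, padicNorm.div, padicNorm.one,
      padicNorm_two] at hu1
    norm_num at hu1
  have h4 : 6 * u ^ 2 - 3 * u - 1 ≠ 0 := fun h => by
    have hN : padicNorm 2 (6 * u - 3) ≤ 1 := by
      refine padicNorm.sub.trans (max_le ?_ padicNorm_three.le)
      rw [padicNorm.mul]
      exact mul_le_one₀ (by simpa using padicNorm.of_nat (p := 2) 6) (padicNorm.nonneg _) hu1.le
    -- A root would satisfy `u(6u - 3) = 1`, with norm below 1 on the left.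
    have hprod := congrArg (padicNorm 2) (show u * (6 * u - 3) = 1 by linarith)
    rw [padicNorm.mul, padicNorm.one] at hprod
    exact absurd hprod (mul_lt_one_of_nonneg_of_lt_one_left (padicNorm.nonneg _) hu1 hN).ne
  refine ⟨fun h => h2 ?_, by simpa [paramY] using hu, fun h => ?_, ?_⟩
  · simp [paramY] at h
    linarith
  · have h' : 4 * u * (2 * v + 1 - 2 * u) = 0 := by
      simp [paramY] at h
      linarith
    have hv' := (mul_eq_zero.1 h').resolve_left (by simpa using hu)
    obtain rfl : v = u - 1 / 2 := by linarith
    have : (2 * u - 1) * ((2 * u + 1) * (u - 1)) = 0 := by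
      rw [← hv, vQuad]; ring
    exact mul_ne_zero h2 (mul_ne_zero h3 h1) this
  · by_contra! h
    obtain ⟨hy2, hy3⟩ := h
    simp [paramY] at hy2 hy3
    have huv : 4 * u * v = 1 := by linarith
    have : 2 * ((u - 1) * ((2 * u + 1) * (6 * u ^ 2 - 3 * u - 1))) = 0 := by
      rw [vQuad] at hv
      -- `2uQ` is a polynomial in `u` and `4uv`, and setting `4uv = 1` leaves the stated product.
      linear_combination 2 * u * hv + (-12 * u * v - 3 + (4 * u - 1) ^ 2) * huv
    exact mul_ne_zero two_ne_zero (mul_ne_zero h1 (mul_ne_zero h3 h4)) this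

theorem isSolution_of_multiple {k s₁ s₂ : ℕ} {x : Fin s₁ → ℤ} {y : Fin s₂ → ℤ} {a : Fin s₁ → ℚ}
    {b : Fin s₂ → ℚ} (h : IsSolution k a b) (c : ℚ) (hx : ∀ i, (x i : ℚ) = c * a i)
    (hy : ∀ j, (y j : ℚ) = c * b j) : IsSolution k x y := by
  intro r h1 hr
  have := h r h1 hr
  have hc : ((∑ i, x i ^ r : ℤ) : ℚ) = ((∑ j, y j ^ r : ℤ) : ℚ) := by
    push_cast
    simp only [hx, hy, mul_pow, ← Finset.mul_sum, this]
  exact_mod_cast hc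

theorem exists_primitive_solution (k : ℕ) :
    ∃ s : (Fin 3 → ℤ) × (Fin 5 → ℤ),
      (IsSolution 4 s.1 s.2 ∧ ¬ IsTrivial s.1 s.2 ∧ IsPrimitive s.1 s.2 ∧
        ∃ (n : ℕ) (X Y : ℚ) (h : E.Nonsingular X Y), n • P = .some X Y h ∧
          ComesFrom X Y s.1 s.2) ∧
      padicNorm 2 (1 + (s.2 0 : ℚ) / s.2 1) = 2 ^ (k + 2) := by
  obtain ⟨X, Y, h, hP, hX, hY⟩ := exists_two_pow_smul_P k
  have hq : (2 : ℚ) ≤ 2 ^ (k + 1) := by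
    simpa using pow_le_pow_right₀ (one_le_two (α := ℚ)) (Nat.le_add_left 1 k)
  obtain ⟨hd, hN⟩ := padicNorm_toU hq hX hY
  have hQ := onQuartic_toU_toT ((E_equation_iff X Y).1 h.1) hd
  generalize hu : toU X Y = u at hN hQ
  generalize ht : toT X Y = t at hQ
  have hu0 : u ≠ 0 := by
    rintro rfl
    rw [padicNorm.zero] at hN
    exact absurd hN (by positivity)
  have hu1 : padicNorm 2 u < 1 := by
    rw [hN, div_lt_one (by positivity)]
    linarith
  have hv := (vQuad_eq_zero_iff hu0 hQ _).2 (.inl rfl)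
  generalize hvt : vRoot u t = v at hv
  obtain ⟨h0, h1, h4, h23⟩ := paramY_ne_zero (w := wNum u v / v) hu0 hu1 hv
  have hv0 : v ≠ 0 := vQuad_root_ne_zero hu0 (by
    simp [paramY] at h0
    exact fun h => h0 (by linarith)) hv
  have hsol := isSolution_four_param (w := wNum u v / v) hv0 (mul_div_cancel₀ _ hv0)
    (.inr (.inr hv))
  obtain ⟨c, g, hc, hg, hprim⟩ := exists_primitive_multiple
    (Sum.elim (paramX u v (wNum u v / v)) (paramY u v (wNum u v / v))) (i₀ := .inr 0) h0
  have hgx : ∀ i, (g (.inl i) : ℚ) = c * paramX u v (wNum u v / v) i := fun i => hg (.inl i)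
  have hgy : ∀ j, (g (.inr j) : ℚ) = c * paramY u v (wNum u v / v) j := fun j => hg (.inr j)
  have hne : ∀ j, paramY u v (wNum u v / v) j ≠ 0 → g (.inr j) ≠ 0 := fun j hj hgj =>
    mul_ne_zero hc hj (by rw [← hgy, hgj, Int.cast_zero])
  refine ⟨(fun i => g (.inl i), fun j => g (.inr j)),
    ⟨isSolution_of_multiple hsol c hgx hgy,
      not_isTrivial (hne _ h0) (hne _ h1) (hne _ h4) (h23.imp (hne _) (hne _)),
      fun d hdx hdy => hprim d (Sum.rec hdx hdy), _, X, Y, h, hP, hd,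
      u, t, v, _, c, hu.symm, ht.symm, hu0, hvt.symm, hv0, rfl, hc, hgx, hgy⟩, ?_⟩
  -- The scalar `c` cancels in `y₀/y₁ = (4u - 2)/(-4u)`, so the integer solution still determines
  -- `u`.
  have : 1 + (g (.inr 0) : ℚ) / g (.inr 1) = 1 / (2 * u) := by
    rw [hgy, hgy]
    simp [paramY]
    field_simp
    ring
  simp only [this]
  rw [padicNorm.div, padicNorm.mul, hN, padicNorm.one, padicNorm_two, pow_succ _ (k + 1)]
  field_simp

theorem infinite_primitive_solutions :
    {s : (Fin 3 → ℤ) × (Fin 5 → ℤ) |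
      IsSolution 4 s.1 s.2 ∧ ¬ IsTrivial s.1 s.2 ∧ IsPrimitive s.1 s.2 ∧
      ∃ (n : ℕ) (X Y : ℚ) (h : E.Nonsingular X Y), n • P = .some X Y h ∧
        ComesFrom X Y s.1 s.2}.Infinite := by
  choose s hs hN using exists_primitive_solution
  refine Set.infinite_of_injective_forall_mem (f := s) (fun k l hkl => ?_) hs
  have h := hN k
  rw [hkl, hN l] at h
  have := pow_right_injective₀ (two_pos (α := ℚ)) (by norm_num) h
  omega

end TarryEscott

theorem mainTheorem7 :
    -- the parametrization solves the equations of degrees 1 and 2 identically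
    (∀ u v w : ℚ, TarryEscott.IsSolution 2
      (TarryEscott.paramX u v w) (TarryEscott.paramY u v w)) ∧
    -- apart from `u = 0` and `u = 1/2`, it solves the full system iff `w` is the stated function
    -- of `u, v` and `v` is a root of the stated quadratic
    (∀ u v w : ℚ, u ≠ 0 → 2 * u - 1 ≠ 0 →
      (TarryEscott.IsSolution 4 (TarryEscott.paramX u v w) (TarryEscott.paramY u v w) ↔
        v * w = TarryEscott.wNum u v ∧ TarryEscott.vQuad u v = 0)) ∧
    -- the cases `u = 0` and `u = 1/2` give trivial solutions only
    (∀ u v w : ℚ, u = 0 ∨ 2 * u - 1 = 0 → v ≠ 0 → w = TarryEscott.wNum u v / v →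
      TarryEscott.IsSolution 4 (TarryEscott.paramX u v w) (TarryEscott.paramY u v w) ∧
      TarryEscott.IsTrivial (TarryEscott.paramX u v w) (TarryEscott.paramY u v w)) ∧
    -- the quadratic has a rational root iff the quartic takes a square value
    (∀ u : ℚ, u ≠ 0 →
      ((∃ v : ℚ, TarryEscott.vQuad u v = 0) ↔ ∃ t : ℚ, TarryEscott.OnQuartic u t)) ∧
    -- every rational point of the quartic gives a solution
    (∀ u t : ℚ, u ≠ 0 → TarryEscott.OnQuartic u t →
      (∀ v : ℚ, TarryEscott.vQuad u v = 0 ↔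
        v = TarryEscott.vRoot u t ∨ v = TarryEscott.vRoot u (-t)) ∧
      (2 * u - 1 ≠ 0 → TarryEscott.vRoot u t ≠ 0) ∧
      ∀ v w : ℚ, v = TarryEscott.vRoot u t → v ≠ 0 → w = TarryEscott.wNum u v / v →
        TarryEscott.IsSolution 4 (TarryEscott.paramX u v w) (TarryEscott.paramY u v w)) ∧
    -- the quartic is birational to `Y² = X³ - 36X` over `ℚ`, by the stated formulas
    (∃ φ : TarryEscott.QuarticFunctionField ≃ₐ[ℚ] TarryEscott.E.FunctionField,
      φ TarryEscott.uGen = TarryEscott.toU TarryEscott.xGen TarryEscott.yGen ∧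
      φ TarryEscott.tGen = TarryEscott.toT TarryEscott.xGen TarryEscott.yGen ∧
      φ.symm TarryEscott.xGen = TarryEscott.toX TarryEscott.uGen TarryEscott.tGen ∧
      φ.symm TarryEscott.yGen = TarryEscott.toY TarryEscott.uGen TarryEscott.tGen) ∧
    -- the same on rational points
    (∀ X Y : ℚ, TarryEscott.E.Equation X Y → 4 * X + Y - 12 ≠ 0 →
      TarryEscott.OnQuartic (TarryEscott.toU X Y) (TarryEscott.toT X Y) ∧
      (TarryEscott.toU X Y ≠ 0 →
        TarryEscott.toX (TarryEscott.toU X Y) (TarryEscott.toT X Y) = X ∧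
        TarryEscott.toY (TarryEscott.toU X Y) (TarryEscott.toT X Y) = Y)) ∧
    (∀ u t : ℚ, TarryEscott.OnQuartic u t → u ≠ 0 →
      TarryEscott.E.Equation (TarryEscott.toX u t) (TarryEscott.toY u t) ∧
      (4 * TarryEscott.toX u t + TarryEscott.toY u t - 12 ≠ 0 →
        TarryEscott.toU (TarryEscott.toX u t) (TarryEscott.toY u t) = u ∧
        TarryEscott.toT (TarryEscott.toX u t) (TarryEscott.toY u t) = t)) ∧
    -- `Y² = X³ - 36X` is an elliptic curve on which `(-3, 9)` has infinite order
    WeierstrassCurve.IsElliptic TarryEscott.E ∧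
    (∀ n : ℕ, 0 < n → n • TarryEscott.P ≠ 0) ∧
    -- the multiples of `(-3, 9)` give infinitely many nontrivial primitive integer solutions
    {s : (Fin 3 → ℤ) × (Fin 5 → ℤ) |
      TarryEscott.IsSolution 4 s.1 s.2 ∧ ¬ TarryEscott.IsTrivial s.1 s.2 ∧
      TarryEscott.IsPrimitive s.1 s.2 ∧
      ∃ (n : ℕ) (X Y : ℚ) (h : TarryEscott.E.Nonsingular X Y),
        n • TarryEscott.P = WeierstrassCurve.Affine.Point.some X Y h ∧
        TarryEscott.ComesFrom X Y s.1 s.2}.Infinite ∧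
    -- in particular there are infinitely many such solutions
    {s : (Fin 3 → ℤ) × (Fin 5 → ℤ) |
      TarryEscott.IsSolution 4 s.1 s.2 ∧ ¬ TarryEscott.IsTrivial s.1 s.2 ∧
      TarryEscott.IsPrimitive s.1 s.2}.Infinite := by
  refine ⟨TarryEscott.isSolution_two_param,
    fun u v w hu hu' => TarryEscott.isSolution_four_param_iff hu hu',
    fun u v w hu hv hw => ⟨TarryEscott.isSolution_four_param hv (by rw [hw, mul_div_cancel₀ _ hv])
      (hu.imp_right .inl), TarryEscott.isTrivial_param hu hv hw⟩,
    fun u hu => TarryEscott.exists_vQuad_root_iff hu,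
    fun u t hu h => ⟨TarryEscott.vQuad_eq_zero_iff hu h, fun hu' =>
      TarryEscott.vQuad_root_ne_zero hu hu' ((TarryEscott.vQuad_eq_zero_iff hu h _).2 (.inl rfl)),
      fun v w hv hv0 hw => TarryEscott.isSolution_four_param hv0
        (by rw [hw, mul_div_cancel₀ _ hv0])
        (.inr (.inr ((TarryEscott.vQuad_eq_zero_iff hu h v).2 (.inl hv))))⟩,
    TarryEscott.exists_functionField_algEquiv,
    fun X Y h hd => ?_,
    fun u t h hu => ⟨(TarryEscott.E_equation_iff _ _).2 (TarryEscott.toX_toY_equation h hu),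
      fun hd => ⟨TarryEscott.toU_toX_toY hu hd, TarryEscott.toT_toX_toY h hu hd⟩⟩,
    TarryEscott.E_isElliptic,
    fun n hn => TarryEscott.nsmul_P_ne_zero hn,
    TarryEscott.infinite_primitive_solutions,
    TarryEscott.infinite_primitive_solutions.mono fun s hs => ⟨hs.1, hs.2.1, hs.2.2.1⟩⟩
  have h' := (TarryEscott.E_equation_iff X Y).1 h
  refine ⟨TarryEscott.onQuartic_toU_toT h' hd, fun hu => ?_⟩
  have hX : X - 12 ≠ 0 := fun h0 => hu (by rw [TarryEscott.toU, h0, zero_div])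
  exact ⟨TarryEscott.toX_toU_toT h' hd hX, TarryEscott.toY_toU_toT h' hd hX⟩
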